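/- **Causal de Finetti – multivariate and categorical.** Let $d\ge 0$, let $k_1,\dots,k_d$ be natural numbers, and let $\{(X_{1;n},\dots,X_{d;n})\}_{n\ge 1}$ be an infinite sequence of $d$-tuples of random variables on a probability space $(\Omega,P)$, where each $X_{i;n}$ takes values in $\{1,\dots,k_i\}$. Let $\mathcal G$ be a directed acyclic graph on $\{1,\dots,d\}$. For a node $i$ let $\mathbf{PA}_i$ be the set of its parents, let $\mathbf{ND}_i$ be the set of its non-descendants (nodes $j\neq i$ that are not reachable from $i$ by a directed path), and let $\overline{\mathbf{ND}}_i=\mathbf{ND}_i\setminus\mathbf{PA}_i$. For a set $S$ of nodes let $S_{;n}$ (such as $\mathbf{PA}_{i;n}$) denote the vector $(X_{j;n})_{j\in S}$, and let the index $[n]$ denote the collection of the samples $1,\dots,n$. Assume: 1. The sequence is infinitely exchangeable: for every $N$ and every permutation $\pi$ of $\{1,\dots,N\}$, the first $N$ $d$-tuples have the same joint law in the original order and in the order permuted by $\pi$. 2. For all $i\in\{1,\dots,d\}$ and all $n$, $$X_{i;[n]} \perp\!\!\!\perp \bigl(\overline{\mathbf{ND}}_{i;[n]},\ \mathbf{ND}_{i;n+1}\bigr)\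 \big|\ \mathbf{PA}_{i;[n]}.$$ 3. For every $i$, with positive probability every realization of $\mathbf{PA}_i$ is seen: the event that for each $v\in\prod_{j\in \mathbf{PA}_i}\{1,\dots,k_j\}$ with $P(\mathbf{PA}_{i;1}=v)>0$ there is some $n$ with $\mathbf{PA}_{i;n}=v$ has positive probability. Then there exist probability measures $\nu_1,\dots,\nu_d$, where $\nu_i$ lives on the set of matrices $\boldsymbol\theta_i\in[0,1]^{k_i\times\prod_{j\in \mathbf{PA}_i}k_j}$ all of whose columns sum to $1$ (rows indexed by the values of $X_i$, columns by the joint values of $\mathbf{PA}_i$), such that for every $N$ and all values $x_{i;n}\in\{1,\dots,k_i\}$ $(1\le i\le d,\ 1\le n\le N)$, $$P\bigl(X_{i;n}=x_{i;n}\ \text{for all } i\le d,\ n\le N\bigr)=\int\!\cdots\!\int\ \prod_{n=1}^N\prod_{i=1}^d p(x_{i;n}\mid \mathbf{pa}_{i;n},\boldsymbol\theta_i)\ d\nu_1(\boldsymbol\theta_1)\cdots d\nu_d(\boldsymbol\theta_d),$$ where $\mathbf{pa}_{i;n}=(x_{j;n})_{j\in\mathbf{PA}_i}$ and $p(x\mid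 \mathbf{pa},\boldsymbol\theta_i)=(\boldsymbol\theta_i)_{x,\mathbf{pa}}$. That is, the $\boldsymbol\theta_i$ are independent with laws $\nu_i$. -/

import Mathlib

open MeasureTheory ProbabilityTheory

noncomputable section

namespace CausalDeFinetti

/-- A directed graph is acyclic if no vertex can be reached from itself by a directed path with at
least one edge. -/
def IsDAG {V : Type*} (G : Digraph V) : Prop :=
  ∀ v, ¬ Relation.TransGen G.Adj v v

/-- The parents of `i`. -/
def PA {V : Type*} (G : Digraph V) (i : V) : Set V :=
  {j | G.Adj j i}

/-- The non-descendants of `i`: the nodes other than `i` itself that no directed path from `i`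
reaches. -/
def ND {V : Type*} (G : Digraph V) (i : V) : Set V :=
  {j | j ≠ i ∧ ¬ Relation.TransGen G.Adj i j}

/-- The non-descendants of `i` that are not parents of `i`. -/
def NDbar {V : Type*} (G : Digraph V) (i : V) : Set V :=
  ND G i \ PA G i

/-- A sequence `Z 0, Z 1, …` is infinitely exchangeable if for every `N` and every permutation of
the first `N` terms the joint law of these terms is unchanged. -/
def InfinitelyExchangeable {Ω E : Type*} [MeasurableSpace Ω] [MeasurableSpace E]
    (Z : ℕ → Ω → E) (μ : Measure Ω) : Prop :=
  ∀ (N : ℕ) (σ : Equiv.Perm (Fin N)),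
    μ.map (fun ω (n : Fin N) => Z (σ n) ω) = μ.map (fun ω (n : Fin N) => Z n ω)

/-- Conditional independence of `A` and `B` given a discrete random variable `C`: for every value
`c` that `C` takes with positive probability, `A` and `B` are independent under the conditional
probability given `C = c`. -/
def CondIndepGiven {Ω α β γ : Type*} [MeasurableSpace Ω] [MeasurableSpace α] [MeasurableSpace β]
    (A : Ω → α) (B : Ω → β) (C : Ω → γ) (μ : Measure Ω) : Prop :=
  ∀ c : γ, μ (C ⁻¹' {c}) ≠ 0 → IndepFun A B (μ[|C ⁻¹' {c}])

section Samples

variable {d : ℕ} {k : Fin d → ℕ} {Ω : Type*}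

/-- The variables with index in `S`, in sample `n`. Here `X i n` is the `i`-th variable of the
`n`-th sample, and the samples are numbered `0, 1, 2, …`. -/
def sample (X : (i : Fin d) → ℕ → Ω → Fin (k i)) (S : Set (Fin d)) (n : ℕ) :
    Ω → (j : S) → Fin (k j) :=
  fun ω j => X j n ω

/-- The variables with index in `S`, in the first `n` samples. -/
def firstSamples (X : (i : Fin d) → ℕ → Ω → Fin (k i)) (S : Set (Fin d)) (n : ℕ) :
    Ω → Fin n → (j : S) → Fin (k j) :=
  fun ω m => sample X S m ω

/-- The sequence of `d`-tuples is infinitely exchangeable. -/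
def TuplesExchangeable [MeasurableSpace Ω] (X : (i : Fin d) → ℕ → Ω → Fin (k i))
    (μ : Measure Ω) : Prop :=
  InfinitelyExchangeable (fun n ω (i : Fin d) => X i n ω) μ

/-- For every node `i` and every `n`, the first `n` copies of `X i` are independent of the first `n`
copies of the non-parent non-descendants together with the next copy of all non-descendants, given
the first `n` copies of the parents. -/
def CausalCondIndep [MeasurableSpace Ω] (G : Digraph (Fin d))
    (X : (i : Fin d) → ℕ → Ω → Fin (k i)) (μ : Measure Ω) : Prop :=
  ∀ (i : Fin d) (n : ℕ),
    CondIndepGiven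
      (fun ω (m : Fin n) => X i m ω)
      (fun ω => (firstSamples X (NDbar G i) n ω, sample X (ND G i) n ω))
      (firstSamples X (PA G i) n) μ

/-- For every node `i`, with positive probability the sequence of parent configurations of `i`
attains every configuration that has positive probability in a single sample. -/
def ParentsJointlySeen [MeasurableSpace Ω] (G : Digraph (Fin d))
    (X : (i : Fin d) → ℕ → Ω → Fin (k i)) (μ : Measure Ω) : Prop :=
  ∀ i : Fin d,
    0 < μ {ω | ∀ v : (j : PA G i) → Fin (k j),
      0 < μ (sample X (PA G i) 0 ⁻¹' {v}) → ∃ n : ℕ, sample X (PA G i) n ω = v}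

end Samples

/-- The parameters of node `i`: column-stochastic matrices with one row for each value of the `i`-th
variable and one column for each configuration of its parents. The conditional probability
`p(x | pa, θ)` is the entry `θ x pa`. -/
abbrev Param {d : ℕ} (k : Fin d → ℕ) (G : Digraph (Fin d)) (i : Fin d) : Type :=
  {θ : Fin (k i) → ((j : PA G i) → Fin (k j)) → ℝ //
    (∀ x pa, θ x pa ∈ Set.Icc (0 : ℝ) 1) ∧ ∀ pa, ∑ x, θ x pa = 1}

end CausalDeFinetti

end

namespace CausalDeFinetti

/-! Fix a node, with values `Y` and parent values `C`. The next-sample part of the independence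
assumption, restricted to the parents, says that further covariates carry no information about
earlier `Y`. With exchangeability, the law of finitely many `Y` given the covariates at any finite
set of indices containing theirs depends only on their own covariates (`cond_pattern`). By
Bergelson's intersectivity lemma, `hseen` makes every finite pattern of non-null covariates have
positive probability (`pattern_pos`). So one may condition on seeing each non-null value `r + 1`
times and form the matrix of empirical distributions of `Y`, one column per value. Its mixed moments
converge to the required conditional probabilities, and a limit point of its laws, which exists by
compactness, is `ν i` (`exists_stochasticMatrix_law`).

The same-sample part of the assumption factorizes the joint law over the graph, by removing sinks
one at a time (`measure_ancestral_eq_prod`). The product of the node integrals is one integral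
against the product measure, so the parameters are independent. -/

/-! ### Exchangeability along injections. -/

theorem exists_perm_apply_eq {ι α : Type*} [Finite α] {f g : ι → α} (hf : f.Injective)
    (hg : g.Injective) : ∃ σ : Equiv.Perm α, ∀ a, σ (f a) = g a := by
  classical
  refine ⟨((Equiv.ofInjective f hf).symm.trans (Equiv.ofInjective g hg)).extendSubtype,
    fun a => ?_⟩
  rw [Equiv.extendSubtype_apply_of_mem _ _ (Set.mem_range_self a)]
  simp

/-- The law of an exchangeable sequence along an injection does not depend on the injection. -/
theorem InfinitelyExchangeable.measure_eq {Ω E ι : Type*} [MeasurableSpace Ω] [MeasurableSpace E]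
    [Finite ι] {Z : ℕ → Ω → E} {μ : Measure Ω} (h : InfinitelyExchangeable Z μ)
    (hZ : ∀ n, Measurable (Z n)) {e e' : ι → ℕ} (he : e.Injective) (he' : e'.Injective)
    {S : Set (ι → E)} (hS : MeasurableSet S) :
    μ {ω | (fun a => Z (e a) ω) ∈ S} = μ {ω | (fun a => Z (e' a) ω) ∈ S} := by
  obtain ⟨K, hK⟩ := (Set.finite_range e).bddAbove
  obtain ⟨K', hK'⟩ := (Set.finite_range e').bddAbove
  have h1 : ∀ a, e a < K + K' + 1 := fun a => by have := hK ⟨a, rfl⟩; omega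
  have h2 : ∀ a, e' a < K + K' + 1 := fun a => by have := hK' ⟨a, rfl⟩; omega
  obtain ⟨σ, hσ⟩ := exists_perm_apply_eq (f := fun a => (⟨e' a, h2 a⟩ : Fin (K + K' + 1)))
    (g := fun a => (⟨e a, h1 a⟩ : Fin (K + K' + 1)))
    (fun a b hab => he' (by simpa using hab)) (fun a b hab => he (by simpa using hab))
  have hS' : MeasurableSet {z : Fin (K + K' + 1) → E | (fun a => z ⟨e' a, h2 a⟩) ∈ S} :=
    hS.preimage (by fun_prop : Measurable fun (z : Fin (K + K' + 1) → E) a => z ⟨e' a, h2 a⟩)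
  have := congrArg (fun m => m {z | (fun a => z ⟨e' a, h2 a⟩) ∈ S}) (h _ σ)
  rw [Measure.map_apply (by fun_prop) hS', Measure.map_apply (by fun_prop) hS'] at this
  simpa [hσ] using this

theorem InfinitelyExchangeable.comp {Ω E F : Type*} [MeasurableSpace Ω] [MeasurableSpace E]
    [MeasurableSpace F] {Z : ℕ → Ω → E} {μ : Measure Ω} (h : InfinitelyExchangeable Z μ)
    (hZ : ∀ n, Measurable (Z n)) {f : E → F} (hf : Measurable f) :
    InfinitelyExchangeable (fun n ω => f (Z n ω)) μ := by
  intro N σ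
  have hF : Measurable fun (z : Fin N → E) n => f (z n) := by fun_prop
  have := congrArg (Measure.map fun (z : Fin N → E) n => f (z n)) (h N σ)
  rwa [Measure.map_map hF (by fun_prop), Measure.map_map hF (by fun_prop)] at this

/-! ### Covariate patterns: positivity and conditional laws. -/

section Pattern

variable {Ω α Γ : Type*} [MeasurableSpace Ω] {μ : Measure Ω} [IsProbabilityMeasure μ]
  [MeasurableSpace α] [MeasurableSpace Γ]
  {Y : ℕ → Ω → α} {C : ℕ → Ω → Γ}

theorem measurableSet_pattern {ι : Type*} [Finite ι] [MeasurableSingletonClass Γ]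
    (hC : ∀ n, Measurable (C n)) (e : ι → ℕ) (c : ι → Γ) :
    MeasurableSet {ω | ∀ a, C (e a) ω = c a} := by
  rw [Set.ofPred_forall]
  exact MeasurableSet.iInter fun a => hC _ (measurableSet_singleton _)

/-- If with positive probability every value of positive probability is seen, then every pattern of
such values has positive probability. -/
theorem pattern_pos [Finite Γ] [MeasurableSingletonClass Γ] (hC : ∀ n, Measurable (C n))
    (hexch : InfinitelyExchangeable C μ)
    (hseen : 0 < μ {ω | ∀ v, 0 < μ (C 0 ⁻¹' {v}) → ∃ n, C n ω = v})
    {ι : Type*} [Finite ι] {e : ι → ℕ} (he : e.Injective) {c : ι → Γ}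
    (hc : ∀ a, 0 < μ (C 0 ⁻¹' {c a})) : 0 < μ {ω | ∀ a, C (e a) ω = c a} := by
  let P := {v : Γ // 0 < μ (C 0 ⁻¹' {v})}
  -- There are countably many placements `s`, so one of them has positive probability.
  obtain ⟨s, hs⟩ : ∃ s : P → ℕ, 0 < μ {ω | ∀ v : P, C (s v) ω = v} := by
    by_contra! hno
    refine hseen.ne' (measure_mono_null ?_
      (measure_iUnion_null fun s : P → ℕ => nonpos_iff_eq_zero.1 (hno s)))
    intro ω hω
    choose s hs using fun v : P => hω v v.2
    exact Set.mem_iUnion.2 ⟨s, hs⟩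
  have hsinj : s.Injective := by
    obtain ⟨ω, hω⟩ := nonempty_of_measure_ne_zero hs.ne'
    intro v w hvw
    exact Subtype.ext (by rw [← hω v, ← hω w, hvw])
  obtain ⟨q, hq⟩ := Countable.exists_injective_nat (ℕ × P)
  have hS : MeasurableSet {z : P → Γ | ∀ v, z v = v} := by
    rw [Set.ofPred_forall]
    exact MeasurableSet.iInter fun v => measurable_pi_apply v (measurableSet_singleton _)
  -- Block `j` is a copy of the placement `s` on fresh indices, so all blocks have the same positive
  -- probability. Infinitely many of them meet finitely often with positive probability.
  obtain ⟨t, ht, htpos⟩ := bergelson (μ := μ) (r := μ {ω | ∀ v : P, C (s v) ω = v})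
    (s := fun j : ℕ => {ω | ∀ v : P, C (q (j, v)) ω = v})
    (fun j => measurableSet_pattern hC _ _) hs.ne'
    (fun j => (hexch.measure_eq hC hsinj
      (fun v w hvw => by simpa using hq hvw : (fun v : P => q (j, v)).Injective) hS).le)
  obtain ⟨f, hf⟩ := Countable.exists_injective_nat ι
  let j : ι → ℕ := fun a => ht.natEmbedding t (f a)
  have hj : j.Injective := fun a b hab =>
    hf ((ht.natEmbedding t).injective (Subtype.ext hab))
  have hS' : MeasurableSet {z : ι → Γ | ∀ a, z a = c a} := by
    rw [Set.ofPred_forall]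
    exact MeasurableSet.iInter fun v => measurable_pi_apply v (measurableSet_singleton _)
  -- Each `a` reads the slot for the value `c a` in its own block, which allows repeated values.
  have key := hexch.measure_eq hC he (e' := fun a => q (j a, ⟨c a, hc a⟩))
    (fun a b hab => hj (congrArg Prod.fst (hq hab))) hS'
  simp only [Set.mem_ofPred_eq] at key
  rw [key]
  refine (htpos (u := Set.range j) ?_ (Set.finite_range j)).trans_le (measure_mono ?_)
  · rintro _ ⟨a, rfl⟩
    exact (ht.natEmbedding t (f a)).2
  · intro ω hω a
    simp only [Set.mem_iInter, Set.mem_ofPred_eq] at hω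
    exact hω (j a) ⟨a, rfl⟩ ⟨c a, hc a⟩

/-- Induction on `M`: given the first `M` covariates, the next one is independent of the first `M`
values of `Y`, so also conditioning on it changes nothing. -/
theorem cond_pattern_of_le [MeasurableSingletonClass α] [MeasurableSingletonClass Γ]
    (hC : ∀ n, Measurable (C n))
    (hCI : ∀ n, CondIndepGiven (fun ω (m : Fin n) => Y m ω) (C n)
      (fun ω (m : Fin n) => C m ω) μ)
    {n M : ℕ} (hnM : n ≤ M) (y : Fin n → α) (c : ℕ → Γ)
    (hc : μ {ω | ∀ m : Fin M, C m ω = c m} ≠ 0) :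
    μ[|{ω | ∀ m : Fin M, C m ω = c m}] {ω | ∀ m : Fin n, Y m ω = y m} =
      μ[|{ω | ∀ m : Fin n, C m ω = c m}] {ω | ∀ m : Fin n, Y m ω = y m} := by
  induction M, hnM using Nat.le_induction with
  | base => rfl
  | succ M hnM ih =>
    have hsplit : {ω | ∀ m : Fin (M + 1), C m ω = c m} =
        {ω | ∀ m : Fin M, C m ω = c m} ∩ C M ⁻¹' {c M} := by
      ext ω
      simp [Fin.forall_fin_succ']
    have hM : μ {ω | ∀ m : Fin M, C m ω = c m} ≠ 0 := fun h0 =>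
      hc (measure_mono_null (hsplit.trans_subset Set.inter_subset_left) h0)
    have hmM := measurableSet_pattern hC (fun m : Fin M => (m : ℕ)) (fun m => c m)
    have hmC : MeasurableSet (C M ⁻¹' {c M}) := hC M (measurableSet_singleton _)
    rw [← ih hM, hsplit, ← cond_cond_eq_cond_inter hmM hmC, cond_apply hmC]
    have hpre : (fun ω (m : Fin M) => C m ω) ⁻¹' {fun m : Fin M => c m} =
        {ω | ∀ m : Fin M, C m ω = c m} := by
      ext ω
      simp [funext_iff]
    have hind := hCI M (fun m => c m) (by rwa [hpre])
    rw [hpre] at hind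
    have := hind.measure_inter_preimage_eq_mul
      {z : Fin M → α | ∀ m : Fin n, z (m.castLE hnM) = y m} {c M} (by
        rw [Set.ofPred_forall]
        exact MeasurableSet.iInter fun v => measurable_pi_apply _ (measurableSet_singleton _))
      (measurableSet_singleton _)
    simp only [Set.preimage_ofPred_eq, Fin.val_castLE] at this
    rw [Set.inter_comm, this, mul_comm, mul_assoc, ENNReal.mul_inv_cancel, mul_one]
    · rw [cond_apply hmM, ← hsplit]
      exact mul_ne_zero (ENNReal.inv_ne_zero.2 (measure_ne_top _ _)) hc
    · exact measure_ne_top _ _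

/-- Given the values of `C` along an injection, the law of the values of `Y` along a part of it
depends only on the values of `C` in that part. -/
theorem cond_pattern [MeasurableSingletonClass α] [MeasurableSingletonClass Γ]
    (hY : ∀ n, Measurable (Y n)) (hC : ∀ n, Measurable (C n))
    (hexch : InfinitelyExchangeable (fun n ω => (Y n ω, C n ω)) μ)
    (hCI : ∀ n, CondIndepGiven (fun ω (m : Fin n) => Y m ω) (C n)
      (fun ω (m : Fin n) => C m ω) μ)
    {T : Type*} [Finite T] {e : T → ℕ} (he : e.Injective) (c : T → Γ)
    (hc : μ {ω | ∀ t, C (e t) ω = c t} ≠ 0)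
    {N : ℕ} {g : Fin N → T} (hg : g.Injective) (y : Fin N → α) :
    μ[|{ω | ∀ t, C (e t) ω = c t}] {ω | ∀ n, Y (e (g n)) ω = y n} =
      μ[|{ω | ∀ n : Fin N, C n ω = c (g n)}] {ω | ∀ n : Fin N, Y n ω = y n} := by
  obtain ⟨ω₀⟩ := nonempty_of_isProbabilityMeasure μ
  obtain ⟨M, ⟨e₀⟩⟩ := Finite.exists_equiv_fin T
  have hNM : N ≤ M := by
    simpa using Fintype.card_le_of_injective _ (e₀.injective.comp hg)
  obtain ⟨σ, hσ⟩ := exists_perm_apply_eq (e₀.injective.comp hg) (Fin.castLE_injective hNM)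
  let e₁ : T ≃ Fin M := e₀.trans σ
  have he₁ : ∀ n, ((e₁ (g n) : Fin M) : ℕ) = n := fun n => congrArg Fin.val (hσ n)
  have hinj : (fun t => (e₁ t : ℕ)).Injective := Fin.val_injective.comp e₁.injective
  -- `e₁` numbers `T` so that `g` becomes the initial segment. The default value is never read.
  let c' : ℕ → Γ := Function.extend (fun t => (e₁ t : ℕ)) c fun _ => C 0 ω₀
  have hc' : ∀ t, c' (e₁ t) = c t := fun t => hinj.extend_apply _ _ t
  have hZ : ∀ n, Measurable fun ω => (Y n ω, C n ω) := fun n => (hY n).prodMk (hC n)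
  have hSC : MeasurableSet {z : T → α × Γ | ∀ t, (z t).2 = c t} := by
    rw [Set.ofPred_forall]
    exact MeasurableSet.iInter fun t =>
      (measurable_snd.comp (measurable_pi_apply t)) (measurableSet_singleton _)
  have hSY : MeasurableSet {z : T → α × Γ | ∀ n, (z (g n)).1 = y n} := by
    rw [Set.ofPred_forall]
    exact MeasurableSet.iInter fun n =>
      (measurable_fst.comp (measurable_pi_apply (g n))) (measurableSet_singleton _)
  have k1 := hexch.measure_eq hZ he hinj hSC
  have k2 := hexch.measure_eq hZ he hinj (hSC.inter hSY)
  simp only [Set.mem_inter_iff, Set.mem_ofPred_eq, Set.ofPred_and, he₁] at k1 k2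
  have hset : {ω | ∀ t, C (e₁ t) ω = c t} = {ω | ∀ m : Fin M, C m ω = c' m} := by
    ext ω
    rw [Set.mem_ofPred_eq, Set.mem_ofPred_eq, ← e₁.forall_congr_right]
    simp [hc']
  have key := cond_pattern_of_le hC hCI hNM y c' (by rwa [← hset, ← k1])
  have hset' : {ω | ∀ n : Fin N, C n ω = c' n} = {ω | ∀ n : Fin N, C n ω = c (g n)} := by
    ext ω
    simp [← hc', he₁]
  rw [← hset', ← key, cond_apply (measurableSet_pattern hC _ _), k1, k2, hset,
    cond_apply (measurableSet_pattern hC _ _)]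

end Pattern

/-! ### Stochastic matrices and sampling with replacement. -/

/-- Column-stochastic matrices with rows indexed by `α` and columns indexed by `Γ`. -/
abbrev StochasticMatrix (α Γ : Type*) [Fintype α] : Type _ :=
  {θ : α → Γ → ℝ // (∀ x v, θ x v ∈ Set.Icc (0 : ℝ) 1) ∧ ∀ v, ∑ x, θ x v = 1}

instance {α Γ : Type*} [Fintype α] : CompactSpace (StochasticMatrix α Γ) := by
  have hcl : IsClosed {θ : α → Γ → ℝ |
      (∀ x v, θ x v ∈ Set.Icc (0 : ℝ) 1) ∧ ∀ v, ∑ x, θ x v = 1} := by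
    simp only [Set.ofPred_and, Set.ofPred_forall]
    refine (isClosed_iInter fun x => isClosed_iInter fun v => ?_).inter
      (isClosed_iInter fun v => ?_)
    · exact isClosed_Icc.preimage (by fun_prop : Continuous fun θ : α → Γ → ℝ => θ x v)
    · exact isClosed_eq (by fun_prop) continuous_const
  exact isCompact_iff_compactSpace.1 (IsCompact.of_isClosed_subset
    (isCompact_univ_pi fun _ : α => isCompact_univ_pi fun _ : Γ =>
      isCompact_Icc (a := (0 : ℝ)) (b := 1)) hcl fun θ hθ x _ v _ => hθ.1 x v)

/-- Injective index tuples contribute no error and every other tuple at most `1`; the right side is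
the proportion of non-injective tuples. -/
theorem abs_average_sub_le {N r : ℕ} (hr : 0 < r) {p : (Fin N → Fin r) → ℝ} {q : ℝ}
    (hp : ∀ m, p m ∈ Set.Icc (0 : ℝ) 1) (hq : q ∈ Set.Icc (0 : ℝ) 1)
    (hpq : ∀ m, m.Injective → p m = q) :
    |(∑ m, p m) / (r : ℝ) ^ N - q| ≤ 1 - (r.descFactorial N : ℝ) / (r : ℝ) ^ N := by
  classical
  have hr' : (0 : ℝ) < (r : ℝ) ^ N := by positivity
  have hcard : (r.descFactorial N : ℝ) =
      ∑ m : Fin N → Fin r, if m.Injective then (1 : ℝ) else 0 := by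
    rw [Finset.sum_boole, ← Fintype.card_subtype,
      Fintype.card_congr (Equiv.subtypeInjectiveEquivEmbedding (Fin N) (Fin r)),
      Fintype.card_embedding_eq]
    simp
  have hall : (r : ℝ) ^ N = ∑ _m : Fin N → Fin r, (1 : ℝ) := by simp
  have h1 : (∑ m, p m) / (r : ℝ) ^ N - q = (∑ m, (p m - q)) / (r : ℝ) ^ N := by
    rw [Finset.sum_sub_distrib]
    field_simp
    simp
  have h2 : 1 - (r.descFactorial N : ℝ) / (r : ℝ) ^ N =
      (∑ m : Fin N → Fin r, (1 - if m.Injective then (1 : ℝ) else 0)) / (r : ℝ) ^ N := by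
    rw [Finset.sum_sub_distrib, ← hcard, ← hall]
    field_simp
  rw [h1, h2, abs_div, abs_of_pos hr']
  gcongr
  refine (Finset.abs_sum_le_sum_abs _ _).trans (Finset.sum_le_sum fun m _ => ?_)
  split_ifs with hm
  · simp [hpq m hm]
  · rw [abs_le]
    constructor <;> linarith [(hp m).1, (hp m).2, hq.1, hq.2]

theorem tendsto_descFactorial_div_pow (N : ℕ) :
    Filter.Tendsto (fun r : ℕ => (r.descFactorial N : ℝ) / (r : ℝ) ^ N) Filter.atTop (nhds 1) := by
  refine (Asymptotics.isEquivalent_iff_tendsto_one ?_).1 (isEquivalent_descFactorial N)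
  filter_upwards [Filter.eventually_gt_atTop 0] with r hr
  positivity

/-! ### Empirical matrices and their moments. -/

section Empirical

variable {Ω α Γ : Type*} [Fintype α] [DecidableEq α]

/-- The column `v` of the empirical matrix is the empirical distribution of the first `r + 1` terms
of the sequence `W v`. -/
noncomputable def empirical (W : Γ → ℕ → Ω → α) (r : ℕ) (ω : Ω) : StochasticMatrix α Γ :=
  ⟨fun x v => (∑ m : Fin (r + 1), if W v m ω = x then (1 : ℝ) else 0) / (r + 1 : ℕ), by
    refine ⟨fun x v => ⟨by positivity, ?_⟩, fun v => ?_⟩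
    · rw [div_le_one (by positivity)]
      refine (Finset.sum_le_sum (g := fun _ => (1 : ℝ)) fun m _ => ?_).trans (by simp)
      split_ifs <;> norm_num
    · rw [← Finset.sum_div, Finset.sum_comm]
      simp only [Finset.sum_ite_eq, Finset.mem_univ, if_true]
      rw [Finset.sum_const, Finset.card_univ, Fintype.card_fin, nsmul_eq_mul, mul_one]
      exact div_self (by positivity)⟩

theorem prod_empirical (W : Γ → ℕ → Ω → α) (r : ℕ) (ω : Ω) {N : ℕ} (x : Fin N → α)
    (v : Fin N → Γ) :
    ∏ n, (empirical W r ω).1 (x n) (v n) =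
      (∑ m : Fin N → Fin (r + 1), if ∀ n, W (v n) (m n) ω = x n then (1 : ℝ) else 0) /
        ((r + 1 : ℕ) : ℝ) ^ N := by
  simp only [empirical]
  rw [Finset.prod_div_distrib, Finset.prod_univ_sum, Fintype.piFinset_univ]
  simp only [Fintype.prod_boole, Finset.prod_const, Finset.card_univ, Fintype.card_fin]
  congr!

variable [MeasurableSpace Ω] [MeasurableSpace α] [MeasurableSingletonClass α]

theorem measurable_empirical {W : Γ → ℕ → Ω → α} (hW : ∀ v n, Measurable (W v n)) (r : ℕ) :
    Measurable (empirical W r) := by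
  refine Measurable.subtype_mk (measurable_pi_lambda _ fun x => measurable_pi_lambda _ fun v => ?_)
  refine Measurable.div_const (Finset.measurable_sum _ fun m _ => ?_) _
  exact Measurable.ite (hW v m (measurableSet_singleton x)) measurable_const measurable_const

theorem integral_prod_empirical {μ : Measure Ω} [IsProbabilityMeasure μ] {W : Γ → ℕ → Ω → α}
    (hW : ∀ v n, Measurable (W v n)) (r : ℕ) {N : ℕ} (x : Fin N → α) (v : Fin N → Γ) :
    ∫ ω, ∏ n, (empirical W r ω).1 (x n) (v n) ∂μ =
      (∑ m : Fin N → Fin (r + 1), μ.real {ω | ∀ n, W (v n) (m n) ω = x n}) /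
        ((r + 1 : ℕ) : ℝ) ^ N := by
  have hS : ∀ m : Fin N → Fin (r + 1), MeasurableSet {ω | ∀ n, W (v n) (m n) ω = x n} := by
    intro m
    rw [Set.ofPred_forall]
    exact MeasurableSet.iInter fun n => hW _ _ (measurableSet_singleton _)
  have hind : ∀ m : Fin N → Fin (r + 1),
      (fun ω => if ∀ n, W (v n) (m n) ω = x n then (1 : ℝ) else 0) =
        Set.indicator {ω | ∀ n, W (v n) (m n) ω = x n} 1 := by
    intro m
    ext ω
    simp [Set.indicator_apply]
  simp only [prod_empirical]
  rw [integral_div, integral_finsetSum]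
  · simp only [hind, integral_indicator_one (hS _)]
  · intro m _
    rw [hind]
    exact (integrable_const _).indicator (hS m)

end Empirical

/-! ### De Finetti's theorem for a single node. -/

theorem exists_tendsto_hyperfilter {E : Type*} [MeasurableSpace E] [TopologicalSpace E]
    [T2Space E] [BorelSpace E] [CompactSpace E] (ν : ℕ → ProbabilityMeasure E) :
    ∃ ν₀, Filter.Tendsto ν (Filter.hyperfilter ℕ) (nhds ν₀) :=
  ⟨_, ((Filter.hyperfilter ℕ).map ν).le_nhds_lim⟩

/-- De Finetti's theorem for the conditional law of `Y` given a covariate `C`. -/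
theorem exists_stochasticMatrix_law {Ω α Γ : Type*} [MeasurableSpace Ω] {μ : Measure Ω}
    [IsProbabilityMeasure μ] [Fintype α] [MeasurableSpace α] [MeasurableSingletonClass α]
    [Finite Γ] [MeasurableSpace Γ] [MeasurableSingletonClass Γ] {Y : ℕ → Ω → α} {C : ℕ → Ω → Γ}
    (hY : ∀ n, Measurable (Y n)) (hC : ∀ n, Measurable (C n))
    (hexch : InfinitelyExchangeable (fun n ω => (Y n ω, C n ω)) μ)
    (hCI : ∀ n, CondIndepGiven (fun ω (m : Fin n) => Y m ω) (C n)
      (fun ω (m : Fin n) => C m ω) μ)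
    (hseen : 0 < μ {ω | ∀ v, 0 < μ (C 0 ⁻¹' {v}) → ∃ n, C n ω = v}) :
    ∃ ν : ProbabilityMeasure (StochasticMatrix α Γ), ∀ (N : ℕ) (x : Fin N → α) (c : Fin N → Γ),
      μ {ω | ∀ n : Fin N, C n ω = c n} ≠ 0 →
        (μ[|{ω | ∀ n : Fin N, C n ω = c n}]).real {ω | ∀ n : Fin N, Y n ω = x n} =
          ∫ θ, ∏ n, θ.1 (x n) (c n) ∂(ν : Measure (StochasticMatrix α Γ)) := by
  classical
  have hZ : ∀ n, Measurable fun ω => (Y n ω, C n ω) := fun n => (hY n).prodMk (hC n)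
  have hexchC : InfinitelyExchangeable C μ := hexch.comp hZ measurable_snd
  obtain ⟨v₀, hv₀⟩ : ∃ v₀, 0 < μ (C 0 ⁻¹' {v₀}) := by
    by_contra! hno
    have : μ (⋃ v, C 0 ⁻¹' {v}) = 0 :=
      measure_iUnion_null fun v => nonpos_iff_eq_zero.1 (hno v)
    rw [← Set.preimage_iUnion, Set.iUnion_of_singleton, Set.preimage_univ, measure_univ] at this
    exact one_ne_zero this
  -- Null covariate values are replaced by `v₀`, so that every column has data; such columns never
  -- enter the claim.
  let φ : Γ → Γ := fun v => if 0 < μ (C 0 ⁻¹' {v}) then v else v₀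
  have hφ : ∀ v, 0 < μ (C 0 ⁻¹' {φ v}) := by
    intro v
    by_cases h : 0 < μ (C 0 ⁻¹' {v}) <;> simp [φ, h, hv₀]
  obtain ⟨e, he⟩ := Countable.exists_injective_nat (Γ × ℕ)
  let eT : (r : ℕ) → Γ × Fin (r + 1) → ℕ := fun r t => e (t.1, t.2)
  have heT : ∀ r, (eT r).Injective := fun r t t' htt => by
    have := he htt
    simp only [Prod.mk.injEq, Fin.val_inj] at this
    exact Prod.ext this.1 this.2
  let A : ℕ → Set Ω := fun r => {ω | ∀ t, C (eT r t) ω = φ t.1}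
  have hA : ∀ r, μ (A r) ≠ 0 := fun r =>
    (pattern_pos hC hexchC hseen (heT r) (c := fun t => φ t.1) fun t => hφ _).ne'
  have hprob : ∀ r, IsProbabilityMeasure (μ[|A r]) := fun r =>
    cond_isProbabilityMeasure (hA r)
  let W : Γ → ℕ → Ω → α := fun v n => Y (e (v, n))
  have hW : ∀ v n, Measurable (W v n) := fun v n => hY _
  let ν : ℕ → ProbabilityMeasure (StochasticMatrix α Γ) := fun r =>
    ⟨(μ[|A r]).map (empirical W r),
      Measure.isProbabilityMeasure_map (measurable_empirical hW r).aemeasurable⟩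
  obtain ⟨ν₀, hν₀⟩ := exists_tendsto_hyperfilter ν
  refine ⟨ν₀, fun N x c hc => ?_⟩
  set q := (μ[|{ω | ∀ n : Fin N, C n ω = c n}]).real {ω | ∀ n : Fin N, Y n ω = x n} with hq
  have hcpos : ∀ n, φ (c n) = c n := by
    intro n
    have hn : 0 < μ (C n ⁻¹' {c n}) :=
      (pos_iff_ne_zero.2 hc).trans_le (measure_mono fun ω hω => hω n)
    have : μ (C 0 ⁻¹' {c n}) = μ (C n ⁻¹' {c n}) :=
      hexchC.measure_eq hC (ι := Unit) (e := fun _ => 0) (e' := fun _ => n)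
        (fun _ _ _ => rfl) (fun _ _ _ => rfl) (S := {z | z () = c n})
        (measurable_pi_apply () (measurableSet_singleton _))
    simp [φ, this, hn]
  have hcont : Continuous fun θ : StochasticMatrix α Γ => ∏ n, θ.1 (x n) (c n) :=
    continuous_finsetProd _ fun n _ =>
      (by fun_prop : Continuous fun θ : α → Γ → ℝ => θ (x n) (c n)).comp continuous_subtype_val
  have hint : ∀ r, ∫ θ, ∏ n, θ.1 (x n) (c n) ∂(ν r : Measure (StochasticMatrix α Γ)) =
      (∑ m : Fin N → Fin (r + 1), (μ[|A r]).real {ω | ∀ n, W (c n) (m n) ω = x n}) /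
        ((r + 1 : ℕ) : ℝ) ^ N := by
    intro r
    rw [← integral_prod_empirical hW]
    exact integral_map (measurable_empirical hW r).aemeasurable
      hcont.measurable.aestronglyMeasurable
  have hlim : Filter.Tendsto
      (fun r => ∫ θ, ∏ n, θ.1 (x n) (c n) ∂(ν r : Measure (StochasticMatrix α Γ)))
      (Filter.hyperfilter ℕ)
      (nhds (∫ θ, ∏ n, θ.1 (x n) (c n) ∂(ν₀ : Measure (StochasticMatrix α Γ)))) :=
    ProbabilityMeasure.tendsto_iff_forall_integral_tendsto.1 hν₀
      (BoundedContinuousFunction.mkOfCompact ⟨_, hcont⟩)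
  refine tendsto_nhds_unique (Filter.Tendsto.mono_left ?_ Nat.hyperfilter_le_atTop) hlim
  rw [tendsto_iff_norm_sub_tendsto_zero]
  have hb : Filter.Tendsto
      (fun r : ℕ => 1 - ((r + 1).descFactorial N : ℝ) / ((r + 1 : ℕ) : ℝ) ^ N)
      Filter.atTop (nhds 0) := by
    simpa using ((tendsto_descFactorial_div_pow N).comp
      (Filter.tendsto_add_atTop_nat 1)).const_sub 1
  refine squeeze_zero (fun _ => norm_nonneg _) (fun r => ?_) hb
  rw [hint, Real.norm_eq_abs]
  have := cond_isProbabilityMeasure hc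
  -- For injective `m` the indices are distinct even when covariates repeat, so `cond_pattern` gives
  -- exactly `q`.
  refine abs_average_sub_le r.succ_pos (fun m => ⟨measureReal_nonneg, measureReal_le_one⟩)
    ⟨measureReal_nonneg, measureReal_le_one⟩ fun m hm => ?_
  have key := cond_pattern hY hC hexch hCI (heT r) (fun t => φ t.1) (hA r)
    (g := fun n => (c n, m n)) (fun a b hab => hm (congrArg Prod.snd hab)) x
  simp only [hcpos] at key
  exact congrArg ENNReal.toReal key

/-! ### Factorization over the graph. -/

theorem CondIndepGiven.mono {Ω α β γ β' : Type*} [MeasurableSpace Ω] [MeasurableSpace α]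
    [MeasurableSpace β] [MeasurableSpace β'] {A : Ω → α} {B : Ω → β} {C : Ω → γ} {μ : Measure Ω}
    (h : CondIndepGiven A B C μ) {f : β → β'} (hf : Measurable f) :
    CondIndepGiven A (fun ω => f (B ω)) C μ :=
  fun c hc => (h c hc).comp measurable_id hf

theorem PA_subset_ND {V : Type*} {G : Digraph V} (hG : IsDAG G) (i : V) : PA G i ⊆ ND G i := by
  intro j hj
  refine ⟨?_, fun h => hG i (h.tail hj)⟩
  rintro rfl
  exact hG j (.single hj)

/-- In a finite directed acyclic graph every nonempty set has a node from which no node of the set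
can be reached. -/
theorem IsDAG.exists_sink {V : Type*} [Finite V] {G : Digraph V} (hG : IsDAG G) {S : Set V}
    (hS : S.Nonempty) : ∃ i ∈ S, ∀ j ∈ S, ¬ Relation.TransGen G.Adj i j := by
  let r : V → V → Prop := fun a b => Relation.TransGen G.Adj b a
  have : IsTrans V r := ⟨fun a b c hab hbc => hbc.trans hab⟩
  have : Std.Irrefl r := ⟨hG⟩
  exact (Finite.wellFounded_of_trans_of_irrefl r).has_min S hS

variable {d : ℕ} {k : Fin d → ℕ} {Ω : Type*} [MeasurableSpace Ω] {μ : Measure Ω}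
  [IsProbabilityMeasure μ] {X : (i : Fin d) → ℕ → Ω → Fin (k i)} {G : Digraph (Fin d)}

theorem measurable_sample (hX : ∀ i n, Measurable (X i n)) (S : Set (Fin d)) (n : ℕ) :
    Measurable (sample X S n) :=
  measurable_pi_lambda _ fun j => hX j n

/-- De Finetti's theorem for the conditional law of a node given its parents. -/
theorem exists_param_law (hX : ∀ i n, Measurable (X i n)) (hexch : TuplesExchangeable X μ)
    (hG : IsDAG G) (hCI : CausalCondIndep G X μ) (hseen : ParentsJointlySeen G X μ) (i : Fin d) :
    ∃ ν : ProbabilityMeasure (Param k G i),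
      ∀ (N : ℕ) (x : Fin N → Fin (k i)) (c : Fin N → (j : PA G i) → Fin (k j)),
        μ {ω | ∀ n : Fin N, sample X (PA G i) n ω = c n} ≠ 0 →
          (μ[|{ω | ∀ n : Fin N, sample X (PA G i) n ω = c n}]).real
              {ω | ∀ n : Fin N, X i n ω = x n} =
            ∫ θ, ∏ n, θ.1 (x n) (c n) ∂(ν : Measure (Param k G i)) := by
  refine exists_stochasticMatrix_law (hX i) (measurable_sample hX _) ?_ ?_ (hseen i)
  · exact InfinitelyExchangeable.comp hexch (fun n => measurable_pi_lambda _ fun i => hX i n)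
      (f := fun z => (z i, fun j : PA G i => z j)) (by fun_prop)
  · intro n
    exact (hCI i n).mono
      (f := fun z => fun j : PA G i => z.2 ⟨j, PA_subset_ND hG i j.2⟩) (by fun_prop)

/-- A sink of `S` has the rest of `S` among its non-descendants, and removing it leaves a set closed
under parents. Given its parents it is independent of the rest, so it splits off one factor. -/
theorem measure_ancestral_eq_prod (hX : ∀ i n, Measurable (X i n)) (hG : IsDAG G)
    (hCI : CausalCondIndep G X μ) {N : ℕ} (x : (i : Fin d) → Fin N → Fin (k i)) {I : Fin d → ℝ}
    (hI : ∀ i, μ {ω | ∀ n : Fin N, sample X (PA G i) n ω = fun j : PA G i => x j n} ≠ 0 →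
      (μ[|{ω | ∀ n : Fin N, sample X (PA G i) n ω = fun j : PA G i => x j n}]).real
        {ω | ∀ n : Fin N, X i n ω = x i n} = I i)
    (S : Finset (Fin d)) (hS : ∀ i ∈ S, PA G i ⊆ S) :
    μ.real {ω | ∀ i ∈ S, ∀ n : Fin N, X i n ω = x i n} = ∏ i ∈ S, I i := by
  induction S using Finset.strongInduction with
  | H S ih =>
    rcases S.eq_empty_or_nonempty with rfl | hne
    · simp
    obtain ⟨i, hiS, hi⟩ := hG.exists_sink (S := (S : Set (Fin d))) hne
    have hPA : PA G i ⊆ (S.erase i : Finset (Fin d)) := fun j hj =>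
      Finset.mem_coe.2 (Finset.mem_erase.2 ⟨(PA_subset_ND hG i hj).1, hS i hiS hj⟩)
    have hS' : ∀ j ∈ S.erase i, PA G j ⊆ (S.erase i : Finset (Fin d)) := by
      intro j hj l hl
      refine Finset.mem_coe.2 (Finset.mem_erase.2 ⟨?_, hS j (Finset.mem_of_mem_erase hj) hl⟩)
      rintro rfl
      exact hi j (Finset.mem_of_mem_erase hj) (.single hl)
    have hND : ∀ j ∈ S.erase i, j ∈ ND G i := fun j hj =>
      ⟨Finset.ne_of_mem_erase hj, hi j (Finset.mem_of_mem_erase hj)⟩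
    have ih' := ih _ (Finset.erase_ssubset hiS) hS'
    rw [← Finset.mul_prod_erase S I hiS, ← ih']
    set A := {ω | ∀ n : Fin N, sample X (PA G i) n ω = fun j : PA G i => x j n}
    set B := {ω | ∀ n : Fin N, X i n ω = x i n}
    set D := {ω | ∀ j ∈ S.erase i, ∀ n : Fin N, X j n ω = x j n}
    have hBD : {ω | ∀ j ∈ S, ∀ n : Fin N, X j n ω = x j n} = B ∩ D := by
      ext ω
      constructor
      · exact fun h => ⟨h i hiS, fun j hj => h j (Finset.mem_of_mem_erase hj)⟩
      · rintro ⟨h1, h2⟩ j hj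
        by_cases hji : j = i
        · subst hji; exact h1
        · exact h2 j (Finset.mem_erase.2 ⟨hji, hj⟩)
    have hDA : D ⊆ A := fun ω hω n => funext fun j => hω j (hPA j.2) n
    rw [hBD]
    -- Here `I i` is unconstrained, but the factor `μ.real D` vanishes.
    by_cases hA0 : μ A = 0
    · have hD0 : μ D = 0 := measure_mono_null hDA hA0
      rw [measureReal_def, measureReal_def, hD0, measure_mono_null Set.inter_subset_right hD0]
      simp
    have hAm : MeasurableSet A := measurableSet_pattern (measurable_sample hX _) _ _
    have hpre : firstSamples X (PA G i) N ⁻¹' {fun n (j : PA G i) => x j n} = A := by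
      ext ω
      simp [firstSamples, funext_iff, A]
    have hind := hCI i N (fun n j => x j n) (by rwa [hpre])
    rw [hpre] at hind
    let T : Set ((Fin N → (j : NDbar G i) → Fin (k j)) × ((j : ND G i) → Fin (k j))) :=
      {z | ∀ j : NDbar G i, (j : Fin d) ∈ S.erase i → ∀ n, z.1 n j = x j n}
    have hmul := hind.measure_inter_preimage_eq_mul {x i} T (measurableSet_singleton _)
      (Set.toFinite T).measurableSet
    have hBpre : (fun ω (m : Fin N) => X i m ω) ⁻¹' {x i} = B := by
      ext ω
      simp [funext_iff, B]
    rw [hBpre] at hmul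
    -- `A` fixes the parents and `T` the remaining nodes of `S.erase i`.
    have hAT : A ∩ (fun ω => (firstSamples X (NDbar G i) N ω, sample X (ND G i) N ω)) ⁻¹' T =
        D := by
      ext ω
      constructor
      · rintro ⟨h1, h2⟩ j hj n
        by_cases hjP : j ∈ PA G i
        · exact congrFun (h1 n) ⟨j, hjP⟩
        · exact h2 ⟨j, hND j hj, hjP⟩ hj n
      · exact fun h => ⟨hDA h, fun j hj n => h j hj n⟩
    rw [← hI i hA0, measureReal_def, measureReal_def, measureReal_def, ← ENNReal.toReal_mul]
    congr 1
    rw [cond_apply hAm, cond_apply hAm _ (_ ⁻¹' T), hAT, Set.inter_comm B, ← Set.inter_assoc,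
      hAT] at hmul
    rw [← ENNReal.mul_right_inj (ENNReal.inv_ne_zero.2 (measure_ne_top μ A))
      (ENNReal.inv_ne_top.2 hA0), Set.inter_comm, hmul]
    ring

end CausalDeFinetti

theorem mainTheorem4 {d : ℕ} {k : Fin d → ℕ} {Ω : Type*} [MeasurableSpace Ω]
    (μ : Measure Ω) [IsProbabilityMeasure μ]
    (X : (i : Fin d) → ℕ → Ω → Fin (k i)) (hX : ∀ i n, Measurable (X i n))
    (hexch : CausalDeFinetti.TuplesExchangeable X μ)
    (G : Digraph (Fin d)) (hG : CausalDeFinetti.IsDAG G)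
    (hCI : CausalDeFinetti.CausalCondIndep G X μ)
    (hseen : CausalDeFinetti.ParentsJointlySeen G X μ) :
    ∃ ν : (i : Fin d) → ProbabilityMeasure (CausalDeFinetti.Param k G i),
      ∀ (N : ℕ) (x : (i : Fin d) → Fin N → Fin (k i)),
        μ.real {ω | ∀ (i : Fin d) (n : Fin N), X i n ω = x i n} =
          ∫ θ : (i : Fin d) → CausalDeFinetti.Param k G i,
            ∏ n : Fin N, ∏ i : Fin d, (θ i).1 (x i n) (fun j => x j n)
            ∂(Measure.pi fun i => (ν i : Measure (CausalDeFinetti.Param k G i))) := by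
  choose ν hν using CausalDeFinetti.exists_param_law hX hexch hG hCI hseen
  refine ⟨ν, fun N x => ?_⟩
  have hprod := CausalDeFinetti.measure_ancestral_eq_prod hX hG hCI x
    (I := fun i => ∫ θ, ∏ n, θ.1 (x i n) (fun j => x j n)
      ∂(ν i : Measure (CausalDeFinetti.Param k G i)))
    (fun i hi => hν i N (x i) (fun n j => x j n) hi) Finset.univ (by simp)
  simp only [Finset.mem_univ, true_imp_iff] at hprod
  rw [hprod, ← integral_fintype_prod_eq_prod]
  refine integral_congr_ae (Filter.Eventually.of_forall fun θ => ?_)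
  exact Finset.prod_comm
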